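/- Let $q$ be a prime power and let $\mathbb{F}_q$ be the finite field of order $q$. A polynomial $f\in\mathbb{F}_q[x]$ is an *orthomorphism polynomial* if both maps $x\mapsto f(x)$ and $x\mapsto f(x)-x$ are permutations of $\mathbb{F}_q$. For $f,g\in\mathbb{F}_q[x]$ let $H(f,g)=|\{a\in\mathbb{F}_q : f(a)\neq g(a)\}|$ be their Hamming distance. **Theorem.** Any two orthomorphism polynomials $f,g\in\mathbb{F}_q[x]$ that induce different maps on $\mathbb{F}_q$ satisfy $H(f,g)\ge 3$. Moreover, there exist orthomorphism polynomials $f,g\in\mathbb{F}_q[x]$ with $H(f,g)=3$ if and only if $q\notin\{2,5,8\}$. -/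

import Mathlib

open Polynomial

/-- A polynomial over `F` is a permutation polynomial if `x ↦ f(x)` permutes `F`. -/
def IsPermutationPolynomial {F : Type*} [Field F] (f : F[X]) : Prop :=
  Function.Bijective (fun x : F => f.eval x)

/-- A permutation polynomial is an orthomorphism polynomial if `x ↦ f(x) - x` is also
a permutation of `F`. -/
def IsOrthomorphismPolynomial {F : Type*} [Field F] (f : F[X]) : Prop :=
  IsPermutationPolynomial f ∧ Function.Bijective (fun x : F => f.eval x - x)

/-- The Hamming distance of two polynomials over a finite field: the number of elements of the
field at which their values differ. -/
def polyHammingDist {F : Type*} [Field F] [Fintype F] [DecidableEq F] (f g : F[X]) : ℕ :=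
  hammingDist (fun a : F => f.eval a) (fun a : F => g.eval a)

/-!
Being an orthomorphism, and the Hamming distance, depend only on the additive group of the field,
and by Lagrange interpolation every self-map of a finite field is polynomial. So the question is
about orthomorphisms of the group `F`.

If `f` and `g` disagree at `a`, they also disagree where `g` takes the value `f a` and where
`g x - x` takes the value `f a - a`, and these three points are distinct. If there is no further
disagreement, the two maps differ by a cyclic exchange of three values, which amounts to
`f b - f a = b - c` and `f c - f a = b - a` for the three points `a, b, c`. The existence of such
an `f` is the property `HasThreePointSwitch`, and it is decided in `hasThreePointSwitch_iff_card`.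

* It passes from `G` to `G × H` whenever `H` has an orthomorphism, and it holds for every nontrivial
  `G × G`, by means of an automorphism `M` with `M² - M + 1 = 0`. This settles all proper powers of
  `2` and of `5` except `8` (`hasThreePointSwitch_of_card_eq_pow`).
* In odd characteristic other than `5`, if `-3` is a square then `m² - m + 1` has a root `m`, and
  `x ↦ m x` works. Otherwise a quadratic orthomorphism is used, which multiplies squares by `m` and
  nonsquares by `n`. If `-1` is not a square, the points can be `0, 1, -t²` with `1 + t²` a
  nonsquare. If `-1` is a square then `3` is not, and one of three explicit rational choices works,
  according to the quadratic characters of `2` and `5`.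
* For order `2` there are not enough points, for order `5` some fourth point has no possible image,
  and for order `8` a pigeonhole argument on the complement of a subgroup of order `4` applies.
-/

/-- An orthomorphism of an additive group: a permutation `f` for which `x ↦ f x - x` is also a
permutation. -/
def IsOrthomorphism {G : Type*} [AddGroup G] (f : G → G) : Prop :=
  Function.Bijective f ∧ Function.Bijective (fun x => f x - x)

/-- A group has a three-point switch if it has an orthomorphism `f` and distinct points `a, b, c`
such that replacing the values `f a, f b, f c` by `f b, f c, f a` moves the three differences
`f x - x` among the same three points, in the opposite direction. The two displayed equations
say that `f b - a = f c - c` and `f c - b = f a - a`. -/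
def HasThreePointSwitch (G : Type*) [AddCommGroup G] : Prop :=
  ∃ f : G → G, IsOrthomorphism f ∧ ∃ a b c : G, a ≠ b ∧ b ≠ c ∧ a ≠ c ∧
    f b - f a = b - c ∧ f c - f a = b - a

/-! ### Orthomorphisms at small Hamming distance -/

section Distance

variable {G : Type*} [AddCommGroup G]

/-- Near a point of disagreement there are two more: the point `b` at which `g` takes the value
`f a`, and the point `c` at which `g x - x` takes the value `f a - a`. -/
lemma IsOrthomorphism.exists_disagreements {f g : G → G} (hf : IsOrthomorphism f)
    (hg : IsOrthomorphism g) {a : G} (ha : f a ≠ g a) :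
    ∃ b c, a ≠ b ∧ b ≠ c ∧ a ≠ c ∧ f b ≠ g b ∧ f c ≠ g c ∧
      g b = f a ∧ g c - c = f a - a := by
  obtain ⟨b, hb⟩ := hg.1.2 (f a)
  obtain ⟨c, hc⟩ := hg.2.2 (f a - a)
  dsimp only at hc
  have hab : a ≠ b := by
    rintro rfl
    exact ha hb.symm
  have hac : a ≠ c := by
    rintro rfl
    exact ha (sub_left_injective hc).symm
  refine ⟨b, c, hab, ?_, hac, ?_, ?_, hb, hc⟩
  · rintro rfl
    rw [hb] at hc
    exact hab (sub_right_injective hc).symm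
  · intro h
    exact hab (hf.1.1 (hb.symm.trans h.symm))
  · intro h
    rw [← h] at hc
    exact hac (hf.2.1 hc).symm

variable [Fintype G] [DecidableEq G]

lemma IsOrthomorphism.three_le_hammingDist {f g : G → G} (hf : IsOrthomorphism f)
    (hg : IsOrthomorphism g) {a : G} (ha : f a ≠ g a) : 3 ≤ hammingDist f g := by
  obtain ⟨b, c, hab, hbc, hac, hb, hc, -, -⟩ := hf.exists_disagreements hg ha
  rw [← Finset.card_eq_three.2 ⟨a, b, c, hab, hac, hbc, rfl⟩]
  refine Finset.card_le_card fun x hx => ?_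
  simp only [Finset.mem_insert, Finset.mem_singleton] at hx
  rcases hx with rfl | rfl | rfl <;> simpa

lemma IsOrthomorphism.hasThreePointSwitch {f g : G → G} (hf : IsOrthomorphism f)
    (hg : IsOrthomorphism g) (h : hammingDist f g = 3) : HasThreePointSwitch G := by
  obtain ⟨a, ha⟩ : ∃ a, f a ≠ g a := by
    by_contra! hfg
    rw [funext hfg, hammingDist_self] at h
    omega
  obtain ⟨b, c, hab, hbc, hac, hb, hc, hgb, hgc⟩ := hf.exists_disagreements hg ha
  have key : ∀ x, f x ≠ g x → x = a ∨ x = b ∨ x = c := by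
    have hsub : ({a, b, c} : Finset G) ⊆ Finset.univ.filter fun x => f x ≠ g x := by
      intro x hx
      simp only [Finset.mem_insert, Finset.mem_singleton] at hx
      rcases hx with rfl | rfl | rfl <;> simpa
    have heq := Finset.eq_of_subset_of_card_le hsub
      (by rw [Finset.card_eq_three.2 ⟨a, b, c, hab, hac, hbc, rfl⟩]; exact h.le)
    intro x hx
    have : x ∈ ({a, b, c} : Finset G) := by
      rw [heq]
      simpa using hx
    simpa using this
  have hfb : f b = g c := by
    obtain ⟨y, hy⟩ := hf.1.2 (g c)
    have hyc : y ≠ c := by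
      rintro rfl
      exact hc hy
    rcases key y fun h' => hyc (hg.1.1 (h'.symm.trans hy)) with rfl | rfl | rfl
    · exact absurd (hg.1.1 (hgb.trans hy)) hbc
    · exact hy
    · exact absurd rfl hyc
  have hfc : f c - c = g b - b := by
    obtain ⟨y, hy⟩ := hf.2.2 (g b - b)
    dsimp only at hy
    have hyb : y ≠ b := by
      rintro rfl
      exact hb (sub_left_injective hy)
    rcases key y fun h' => hyb (hg.2.1 (by simpa only [h'] using hy)) with rfl | rfl | rfl
    · exact absurd (hg.2.1 (hgc.trans hy)).symm hbc
    · exact absurd rfl hyb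
    · exact hy
  refine ⟨f, hf, a, c, b, hac, hbc.symm, hab, ?_, ?_⟩
  · rw [hgb] at hfc
    rw [sub_eq_iff_eq_add.1 hfc]
    abel
  · rw [hfb, sub_eq_iff_eq_add.1 hgc]
    abel

lemma HasThreePointSwitch.exists_hammingDist_eq_three (h : HasThreePointSwitch G) :
    ∃ f g : G → G, IsOrthomorphism f ∧ IsOrthomorphism g ∧ hammingDist f g = 3 := by
  obtain ⟨f, hf, a, b, c, hab, hbc, hac, h1, h2⟩ := h
  have hfb : f b = f a + b - c := by rw [sub_eq_iff_eq_add.1 h1]; abel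
  have hfc : f c = f a + b - a := by rw [sub_eq_iff_eq_add.1 h2]; abel
  -- `σ` is the cycle `a ↦ b ↦ c ↦ a`
  let σ : Equiv.Perm G := Equiv.swap a b * Equiv.swap b c
  have σa : σ a = b := by simp [σ, Equiv.swap_apply_of_ne_of_ne hab hac]
  have σb : σ b = c := by simp [σ, Equiv.swap_apply_of_ne_of_ne hac.symm hbc.symm]
  have σc : σ c = a := by simp [σ]
  have σx : ∀ x, x ≠ a → x ≠ b → x ≠ c → σ x = x := by
    intro x ha hb hc
    simp [σ, Equiv.swap_apply_of_ne_of_ne hb hc, Equiv.swap_apply_of_ne_of_ne ha hb]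
  have hdiff : (fun x => f (σ x) - x) = (fun x => f x - x) ∘ σ.symm := by
    funext x
    obtain ⟨y, rfl⟩ := σ.surjective x
    simp only [Function.comp_apply, Equiv.symm_apply_apply]
    by_cases ha : y = a
    · rw [ha, σa, σb, hfc]; abel
    by_cases hb : y = b
    · rw [hb, σb, σc, hfb]; abel
    by_cases hc : y = c
    · rw [hc, σc, σa, hfb, hfc]; abel
    rw [σx y ha hb hc, σx y ha hb hc]
  refine ⟨f, f ∘ σ, hf, ⟨hf.1.comp σ.bijective, ?_⟩, ?_⟩
  · simp only [Function.comp_apply]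
    rw [hdiff]
    exact hf.2.comp σ.symm.bijective
  · rw [← Finset.card_eq_three.2 ⟨a, b, c, hab, hac, hbc, rfl⟩]
    unfold hammingDist
    congr 1
    ext x
    simp only [Finset.mem_filter, Finset.mem_univ, true_and, Function.comp_apply,
      Finset.mem_insert, Finset.mem_singleton, hf.1.1.ne_iff]
    constructor
    · intro hx
      by_contra! h'
      exact hx (σx x h'.1 h'.2.1 h'.2.2).symm
    · rintro (rfl | rfl | rfl)
      · rwa [σa]
      · rwa [σb]
      · rw [σc]
        exact hac.symm

end Distance

/-! ### Transport and products -/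

section Products

variable {G H : Type*} [AddCommGroup G] [AddCommGroup H]

lemma HasThreePointSwitch.of_addEquiv (e : G ≃+ H) (h : HasThreePointSwitch G) :
    HasThreePointSwitch H := by
  obtain ⟨f, hf, a, b, c, hab, hbc, hac, h1, h2⟩ := h
  refine ⟨fun y => e (f (e.symm y)),
    ⟨e.bijective.comp (hf.1.comp e.symm.bijective), ?_⟩,
    e a, e b, e c, e.injective.ne hab, e.injective.ne hbc, e.injective.ne hac, ?_, ?_⟩
  · have : (fun y => e (f (e.symm y)) - y) = e ∘ (fun x => f x - x) ∘ e.symm := by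
      funext y
      simp
    rw [this]
    exact e.bijective.comp (hf.2.comp e.symm.bijective)
  · simp [← map_sub, h1]
  · simp [← map_sub, h2]

lemma HasThreePointSwitch.prod (hG : HasThreePointSwitch G) {k : H → H}
    (hk : IsOrthomorphism k) : HasThreePointSwitch (G × H) := by
  obtain ⟨f, hf, a, b, c, hab, hbc, hac, h1, h2⟩ := hG
  refine ⟨Prod.map f k, ⟨hf.1.prodMap hk.1, hf.2.prodMap hk.2⟩, (a, 0), (b, 0), (c, 0),
    ?_, ?_, ?_, ?_, ?_⟩ <;> simp_all

/-- On `G × G` the automorphism `M (x, y) = (x + y, -x)` satisfies `M² - M + 1 = 0`, and this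
relation is exactly what the points `0`, `(g, 0)`, `(0, g)` require. -/
lemma hasThreePointSwitch_prod_self [Nontrivial G] : HasThreePointSwitch (G × G) := by
  obtain ⟨g, hg⟩ := exists_ne (0 : G)
  refine ⟨fun x => (x.1 + x.2, -x.1), ⟨?_, ?_⟩, 0, (g, 0), (0, g), ?_, ?_, ?_, ?_, ?_⟩
  · exact Function.bijective_iff_has_inverse.2 ⟨fun x => (-x.2, x.1 + x.2),
      fun x => by ext <;> simp, fun x => by ext <;> simp⟩
  · exact Function.bijective_iff_has_inverse.2 ⟨fun x => (-x.2 - x.1, x.1),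
      fun x => by ext <;> simp, fun x => by ext <;> simp⟩
  all_goals simp [Prod.ext_iff, hg, hg.symm]

lemma isOrthomorphism_mul_left {K : Type*} [Field K] {t : K} (h0 : t ≠ 0) (h1 : t ≠ 1) :
    IsOrthomorphism fun x : K => t * x := by
  refine ⟨mulLeft_bijective₀ t h0, ?_⟩
  have : (fun x : K => t * x - x) = fun x => (t - 1) * x := by
    funext x
    ring
  rw [this]
  exact mulLeft_bijective₀ _ (sub_ne_zero.2 h1)

/-- A field of order `p ^ k` with `k ≥ 2` is additively `(ZMod p × ZMod p) × K` for a field `K`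
of order `p ^ (k - 2)`, or `ZMod p × ZMod p` if `k = 2`. The first factor has a three-point
switch, and `K` has an orthomorphism unless it has order two. -/
lemma hasThreePointSwitch_of_card_eq_pow {F : Type*} [Field F] [Fintype F] (p k : ℕ)
    [Fact p.Prime] [CharP F p] (hcard : Fintype.card F = p ^ k) (hk : 2 ≤ k)
    (hpk : p ^ k ≠ 8) : HasThreePointSwitch F := by
  let _ : Algebra (ZMod p) F := ZMod.algebra F p
  have hp : p.Prime := Fact.out
  have hrank : Module.finrank (ZMod p) F = k :=
    Nat.pow_right_injective hp.two_le ((FiniteField.pow_finrank_eq_card p F).trans hcard)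
  have hsq : HasThreePointSwitch (ZMod p × ZMod p) := hasThreePointSwitch_prod_self
  obtain rfl | hk2 := hk.eq_or_lt
  · refine hsq.of_addEquiv (LinearEquiv.ofFinrankEq (R := ZMod p) _ _ ?_).toAddEquiv
    simp [hrank]
  · obtain ⟨j, rfl⟩ := Nat.exists_eq_add_of_lt hk2
    let K := GaloisField p (j + 1)
    classical
    obtain ⟨t, ht⟩ : ∃ t : K, t ∉ ({0, 1} : Finset K) := by
      have : Fintype K := Fintype.ofFinite K
      refine Finset.exists_mem_notMem_of_card_lt_card (t := Finset.univ) ?_ |>.imp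
        fun _ h => h.2
      refine Finset.card_le_two.trans_lt ?_
      rw [Finset.card_univ, ← Nat.card_eq_fintype_card, GaloisField.card _ _ (by omega)]
      by_contra! hle
      have h2 : p = 2 := le_antisymm ((Nat.le_self_pow (by omega) p).trans hle) hp.two_le
      subst h2
      have : j + 1 ≤ 1 := (Nat.pow_le_pow_iff_right (a := 2) (by norm_num)).1 (by simpa using hle)
      obtain rfl : j = 0 := by omega
      norm_num at hpk
    simp only [Finset.mem_insert, Finset.mem_singleton, not_or] at ht
    refine (hsq.prod (isOrthomorphism_mul_left ht.1 ht.2)).of_addEquiv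
      (LinearEquiv.ofFinrankEq (R := ZMod p) _ _ ?_).toAddEquiv
    rw [Module.finrank_prod, Module.finrank_prod, GaloisField.finrank _ (by omega), hrank,
      Module.finrank_self]
    omega

end Products

/-! ### Odd characteristic -/

section Quadratic

variable {F : Type*} [Field F]

/-- If `s² = -3` and `m = (1 + s) / 2`, then `m² - m + 1 = 0` and multiplication by `m` can be
switched at the points `0`, `1`, `1 - m`. -/
lemma hasThreePointSwitch_of_isSquare_neg_three (h2 : (2 : F) ≠ 0) (h : IsSquare (-3 : F)) :
    HasThreePointSwitch F := by
  obtain ⟨s, hs⟩ := h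
  obtain ⟨m, hm⟩ : ∃ m : F, m * m - m + 1 = 0 := by
    refine ⟨(1 + s) / 2, ?_⟩
    field_simp
    linear_combination -hs
  have hm0 : m ≠ 0 := by
    rintro rfl
    simp at hm
  have hm1 : m ≠ 1 := by
    rintro rfl
    simp at hm
  refine ⟨fun x => m * x, isOrthomorphism_mul_left hm0 hm1, 0, 1, 1 - m,
    zero_ne_one, ?_, ?_, ?_, ?_⟩
  · intro h
    exact hm0 (by linear_combination h)
  · intro h
    exact hm1 (by linear_combination h)
  · ring
  · linear_combination -hm

variable [Fintype F]

lemma isSquare_mul_iff_of_ne_zero {m n : F} (hm : m ≠ 0) (hn : n ≠ 0) :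
    IsSquare (m * n) ↔ (IsSquare m ↔ IsSquare n) := by
  classical
  rw [← quadraticChar_one_iff_isSquare (mul_ne_zero hm hn), map_mul,
    ← quadraticChar_one_iff_isSquare hm, ← quadraticChar_one_iff_isSquare hn]
  rcases quadraticChar_dichotomy hm with h | h <;>
    rcases quadraticChar_dichotomy hn with h' | h' <;>
    rw [h, h'] <;> decide

open Classical in
/-- Multiplication by `m` on the squares and by `n` on the nonsquares. -/
noncomputable def quadraticMap (m n x : F) : F := if IsSquare x then m * x else n * x

lemma quadraticMap_bijective {m n : F} (hm : m ≠ 0) (hn : n ≠ 0) (h : IsSquare (m * n)) :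
    Function.Bijective (quadraticMap m n) := by
  rw [← Finite.injective_iff_bijective]
  rw [isSquare_mul_iff_of_ne_zero hm hn] at h
  -- the quadratic character of the value determines that of the argument
  have hsq : ∀ x, IsSquare (quadraticMap m n x) ↔ (x = 0 ∨ (IsSquare m ↔ IsSquare x)) := by
    intro x
    by_cases hx : x = 0
    · simp [quadraticMap, hx]
    · unfold quadraticMap
      split_ifs with hs
      · rw [isSquare_mul_iff_of_ne_zero hm hx]; tauto
      · rw [isSquare_mul_iff_of_ne_zero hn hx]; tauto
  have hzero : ∀ x, quadraticMap m n x = 0 ↔ x = 0 := by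
    intro x
    unfold quadraticMap
    split_ifs <;> simp [hm, hn]
  intro x y hxy
  have h0 : x = 0 ↔ y = 0 := by rw [← hzero x, ← hzero y, hxy]
  have hs : IsSquare x ↔ IsSquare y := by
    by_cases hx : x = 0
    · rw [hx, h0.1 hx]
    · have := hsq x
      rw [hxy, hsq y] at this
      tauto
  unfold quadraticMap at hxy
  split_ifs at hxy with h1 h2 h2
  · exact mul_left_cancel₀ hm hxy
  · tauto
  · tauto
  · exact mul_left_cancel₀ hn hxy

lemma isOrthomorphism_quadraticMap {m n : F} (hm : m ≠ 0) (hn : n ≠ 0) (h : IsSquare (m * n))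
    (hm1 : m ≠ 1) (hn1 : n ≠ 1) (h1 : IsSquare ((m - 1) * (n - 1))) :
    IsOrthomorphism (quadraticMap m n) := by
  refine ⟨quadraticMap_bijective hm hn h, ?_⟩
  convert quadraticMap_bijective (sub_ne_zero.2 hm1) (sub_ne_zero.2 hn1) h1 using 2 with x
  unfold quadraticMap
  split_ifs <;> ring

/-- The three points of a switch for a quadratic orthomorphism, two of them squares and the third
a nonsquare. -/
lemma hasThreePointSwitch_of_quadraticMap {m n a b c : F} (hm : m ≠ 0) (hn : n ≠ 0)
    (h : IsSquare (m * n)) (hm1 : m ≠ 1) (hn1 : n ≠ 1) (h1 : IsSquare ((m - 1) * (n - 1)))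
    (ha : IsSquare a) (hb : IsSquare b) (hc : ¬ IsSquare c)
    (e1 : m * b - m * a = b - c) (e2 : n * c - m * a = b - a) : HasThreePointSwitch F := by
  refine ⟨quadraticMap m n, isOrthomorphism_quadraticMap hm hn h hm1 hn1 h1, a, b, c, ?_,
    fun h => hc (h ▸ hb), fun h => hc (h ▸ ha), ?_, ?_⟩
  · rintro rfl
    exact hc (by rwa [← sub_eq_zero.1 (e1.symm.trans (sub_self _))])
  · simpa [quadraticMap, ha, hb] using e1
  · simpa [quadraticMap, ha, hc] using e2

/-- If `-1` is not a square, write a nonsquare as `x² + y²`; then `t = x / y` has `1 + t²` a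
nonsquare. With `c = -t²`, the quadratic orthomorphism with multipliers `1 - c` and `1 / c` can be
switched at the points `0`, `1`, `c`. -/
lemma hasThreePointSwitch_of_not_isSquare_neg_one (h : ¬ IsSquare (-1 : F)) :
    HasThreePointSwitch F := by
  obtain ⟨x, y, hxy⟩ : ∃ x y : F, -1 = x ^ 2 + y ^ 2 := by
    have hchar : ringChar F ≠ 2 := fun h' => h (FiniteField.isSquare_of_char_two h' _)
    obtain ⟨x, y, hxy⟩ := FiniteField.exists_root_sum_quadratic (R := F)
      (f := X ^ 2) (g := X ^ 2 - C (-1)) (degree_X_pow 2) (degree_X_pow_sub_C (by decide) _)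
      (FiniteField.odd_card_of_char_ne_two hchar)
    refine ⟨x, y, ?_⟩
    simp only [eval_pow, eval_X, eval_sub, eval_C] at hxy
    linear_combination -hxy
  have hx : x ≠ 0 := by
    rintro rfl
    exact h ⟨y, by rw [hxy]; ring⟩
  have hy : y ≠ 0 := by
    rintro rfl
    exact h ⟨x, by rw [hxy]; ring⟩
  set t := x / y with ht
  have ht0 : t ≠ 0 := div_ne_zero hx hy
  have hc : ¬ IsSquare (-t ^ 2) := by
    rintro ⟨z, hz⟩
    refine h ⟨z / t, ?_⟩
    field_simp
    linear_combination hz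
  have hc1 : ¬ IsSquare (1 + t ^ 2) := by
    rintro ⟨z, hz⟩
    refine h ⟨y * z, ?_⟩
    have : x = t * y := by rw [ht]; field_simp
    rw [this] at hxy
    linear_combination hxy + y ^ 2 * hz
  have hc0 : -t ^ 2 ≠ 0 := fun h => hc (h ▸ IsSquare.zero)
  have hc10 : 1 + t ^ 2 ≠ 0 := fun h => hc1 (h ▸ IsSquare.zero)
  have hprod : IsSquare ((1 + t ^ 2) * -t ^ 2) :=
    (isSquare_mul_iff_of_ne_zero hc10 hc0).2 ⟨fun h => absurd h hc1, fun h => absurd h hc⟩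
  obtain ⟨z, hz⟩ := hprod
  refine hasThreePointSwitch_of_quadraticMap (m := 1 + t ^ 2) (n := 1 / -t ^ 2) (a := 0) (b := 1)
    (c := -t ^ 2) hc10 (one_div_ne_zero hc0) ⟨z / t ^ 2, ?_⟩ ?_ ?_ ⟨z / t, ?_⟩ IsSquare.zero
    IsSquare.one hc ?_ ?_
  · field_simp
    linear_combination hz
  · intro h
    exact hc0 (by linear_combination -h)
  · intro h
    rw [div_eq_iff hc0] at h
    exact hc10 (by linear_combination h)
  · field_simp
    linear_combination hz
  · ring
  · field_simp
    ring

/-- Here `-1` is a square and `3` is not. With points `1, b, c`, of which `1` and `b` are squares and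
`c` is not, the equations of a switch force `c = m + (1 - m) b` and `n = (b - 1 + m) / c`, which
leaves `b` and `m` free. The values below are chosen so that the quadratic characters of `b`, `c`,
`m n` and `(m - 1) (n - 1)` depend only on those of `-1`, `2`, `3` and `5`. -/
lemma hasThreePointSwitch_of_isSquare_neg_one (h2 : (2 : F) ≠ 0) (h5 : (5 : F) ≠ 0)
    (h1 : IsSquare (-1 : F)) (h3 : ¬ IsSquare (-3 : F)) : HasThreePointSwitch F := by
  have h30 : (3 : F) ≠ 0 := fun h => h3 (by simp [h])
  obtain ⟨i, hi⟩ := h1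
  have n3 : ¬ IsSquare (3 : F) := by
    rintro ⟨z, hz⟩
    exact h3 ⟨i * z, by linear_combination z * z * hi - hz⟩
  have h40 : (4 : F) ≠ 0 := by convert mul_ne_zero h2 h2 using 1; norm_num
  have h60 : (6 : F) ≠ 0 := by convert mul_ne_zero h2 h30 using 1; norm_num
  have h80 : (8 : F) ≠ 0 := by convert mul_ne_zero h2 h40 using 1; norm_num
  have h90 : (9 : F) ≠ 0 := by convert mul_ne_zero h30 h30 using 1; norm_num
  have h180 : (18 : F) ≠ 0 := by convert mul_ne_zero h2 h90 using 1; norm_num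
  have h100 : (10 : F) ≠ 0 := by convert mul_ne_zero h2 h5 using 1; norm_num
  have h250 : (25 : F) ≠ 0 := by convert mul_ne_zero h5 h5 using 1; norm_num
  have h270 : (27 : F) ≠ 0 := by convert mul_ne_zero h30 h90 using 1; norm_num
  by_cases s2 : IsSquare (2 : F)
  · obtain ⟨w, hw⟩ := s2
    have hw0 : w ≠ 0 := by
      rintro rfl
      simp [h2] at hw
    by_cases s5 : IsSquare (5 : F)
    · obtain ⟨v, hv⟩ := s5
      -- the points are `1, -5/2, -27/8`
      refine hasThreePointSwitch_of_quadraticMap (m := -1 / 4) (n := 10 / 9) (a := 1) (b := -5 / 2)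
        (c := -27 / 8) ?_ ?_ ⟨i * w * v / 6, ?_⟩ ?_ ?_ ⟨i * v / 6, ?_⟩ IsSquare.one
        ⟨i * v / w, ?_⟩ ?_ ?_ ?_
      · simp [h40]
      · simp [h100, h90]
      · rw [div_mul_div_comm, div_mul_div_comm,
          show i * w * v * (i * w * v) = i * i * (w * w) * (v * v) by ring,
          ← hi, ← hw, ← hv]
        field_simp
        norm_num
      · intro h
        rw [div_eq_iff h40] at h
        exact h5 (by linear_combination -h)
      · intro h
        rw [div_eq_iff h90] at h
        exact one_ne_zero (by linear_combination h)
      · rw [div_mul_div_comm, show i * v * (i * v) = i * i * (v * v) by ring,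
          ← hi, ← hv]
        field_simp
        norm_num
      · rw [div_mul_div_comm, show i * v * (i * v) = i * i * (v * v) by ring,
          ← hi, ← hv, ← hw]
        field_simp
      · rintro ⟨z, hz⟩
        refine n3 ⟨2 * i * w * z / 3, ?_⟩
        rw [div_mul_div_comm,
          show 2 * i * w * z * (2 * i * w * z) = 4 * (i * i) * (w * w) * (z * z) by ring,
          ← hi, ← hw, ← hz]
        field_simp
        norm_num
      · field_simp
        ring
      · field_simp
        ring
    · obtain ⟨r, hr⟩ := (isSquare_mul_iff_of_ne_zero h30 h5).2
        ⟨fun h => absurd h n3, fun h => absurd h s5⟩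
      -- the points are `1, 1/2, 3/8`
      refine hasThreePointSwitch_of_quadraticMap (m := -1 / 4) (n := -2) (a := 1) (b := 1 / 2)
        (c := 3 / 8) ?_ ?_ ⟨1 / w, ?_⟩ ?_ ?_ ⟨r / 2, ?_⟩ IsSquare.one
        ⟨1 / w, ?_⟩ ?_ ?_ ?_
      · simp [h40]
      · simp [h2]
      · rw [div_mul_div_comm, one_mul, ← hw]
        field_simp
        norm_num
      · intro h
        rw [div_eq_iff h40] at h
        exact h5 (by linear_combination -h)
      · intro h
        exact h30 (by linear_combination -h)
      · rw [div_mul_div_comm, ← hr]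
        field_simp
        norm_num
      · rw [div_mul_div_comm, one_mul, ← hw]
      · rintro ⟨z, hz⟩
        refine n3 ⟨2 * w * z, ?_⟩
        rw [show 2 * w * z * (2 * w * z) = 4 * (w * w) * (z * z) by ring,
          ← hw, ← hz]
        field_simp
        norm_num
      · field_simp
        ring
      · field_simp
        ring
  · obtain ⟨r, hr⟩ := (isSquare_mul_iff_of_ne_zero h2 h30).2
      ⟨fun h => absurd h s2, fun h => absurd h n3⟩
    -- the points are `1, -8/3, -9/2`
    refine hasThreePointSwitch_of_quadraticMap (m := -1 / 2) (n := 25 / 27) (a := 1) (b := -8 / 3)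
      (c := -9 / 2) ?_ ?_ ⟨5 * i * r / 18, ?_⟩ ?_ ?_ ⟨1 / 3, ?_⟩ IsSquare.one
      ⟨2 * i * r / 3, ?_⟩ ?_ ?_ ?_
    · simp [h2]
    · simp [h250, h270]
    · rw [div_mul_div_comm, div_mul_div_comm,
        show 5 * i * r * (5 * i * r) = 25 * (i * i) * (r * r) by ring,
        ← hi, ← hr]
      field_simp
      norm_num
    · intro h
      rw [div_eq_iff h2] at h
      exact h30 (by linear_combination -h)
    · intro h
      rw [div_eq_iff h270] at h
      exact h2 (by linear_combination -h)
    · field_simp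
      norm_num
    · rw [div_mul_div_comm, show 2 * i * r * (2 * i * r) = 4 * (i * i) * (r * r) by ring,
        ← hi, ← hr]
      field_simp
      norm_num
    · rintro ⟨z, hz⟩
      refine s2 ⟨2 * i * z / 3, ?_⟩
      rw [div_mul_div_comm, show 2 * i * z * (2 * i * z) = 4 * (i * i) * (z * z) by ring,
          ← hi, ← hz]
      field_simp
      norm_num
    · field_simp
      ring
    · field_simp
      ring

end Quadratic

/-! ### The orders five and eight -/

section Small

variable {G : Type*} [AddCommGroup G]

lemma HasThreePointSwitch.exists_normalized (h : HasThreePointSwitch G) :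
    ∃ f : G → G, IsOrthomorphism f ∧ f 0 = 0 ∧ ∃ b c : G, b ≠ 0 ∧ c ≠ 0 ∧ b ≠ c ∧
      f b = b - c ∧ f c = b := by
  obtain ⟨f, hf, a, b, c, hab, hbc, hac, h1, h2⟩ := h
  refine ⟨fun x => f (x + a) - f a, ⟨?_, ?_⟩, by simp, b - a, c - a, sub_ne_zero.2 hab.symm,
    sub_ne_zero.2 hac.symm, fun h => hbc (sub_left_injective h), ?_, ?_⟩
  · exact (Equiv.subRight (f a)).bijective.comp (hf.1.comp (Equiv.addRight a).bijective)
  · have : (fun x => f (x + a) - f a - x) =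
        Equiv.subRight (f a - a) ∘ (fun x => f x - x) ∘ Equiv.addRight a := by
      funext x
      simp only [Function.comp_apply, Equiv.coe_addRight, Equiv.subRight_apply]
      abel
    rw [this]
    exact (Equiv.bijective _).comp (hf.2.comp (Equiv.bijective _))
  · simp [h1]
  · simp [h2]

/-- After normalization some fourth point `x` of `ZMod 5` has no possible image: each `y` repeats
one of the values at `0, b, c`, or one of the differences there. -/
lemma not_hasThreePointSwitch_zmod_five : ¬ HasThreePointSwitch (ZMod 5) := by
  intro h
  obtain ⟨f, hf, h0, b, c, hb, hc, hbc, hfb, hfc⟩ := h.exists_normalized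
  have key : ∀ b c : ZMod 5, b ≠ 0 → c ≠ 0 → b ≠ c → ∃ x, x ≠ 0 ∧ x ≠ b ∧ x ≠ c ∧
      ∀ y, y = 0 ∨ y = b - c ∨ y = b ∨ y - x = 0 - 0 ∨ y - x = b - c - b ∨ y - x = b - c := by
    decide
  obtain ⟨x, hx0, hxb, hxc, hx⟩ := key b c hb hc hbc
  rcases hx (f x) with h | h | h | h | h | h
  · exact hx0 (hf.1.1 (h.trans h0.symm))
  · exact hxb (hf.1.1 (h.trans hfb.symm))
  · exact hxc (hf.1.1 (h.trans hfc.symm))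
  · exact hx0 (hf.2.1 (h.trans (by simp [h0])))
  · exact hxb (hf.2.1 (h.trans (by simp only [hfb])))
  · exact hxc (hf.2.1 (h.trans (by simp only [hfc])))

/-- The subgroup `W = {0, b, c, b + c}` has index two and contains the values and the differences
of `f` at `0, b, c`. For `x ∉ W`, one of `f x` and `f x - x` lies in `W`, so it is the single
element of `W` left over: `c` for the values, `b` for the differences. This allows at most two
points outside `W`, but there are four. -/
lemma not_hasThreePointSwitch_of_card_eq_eight [Fintype G] (h2 : ∀ x : G, x + x = 0)
    (hcard : Fintype.card G = 8) : ¬ HasThreePointSwitch G := by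
  intro h
  obtain ⟨f, hf, h0, b, c, hb, hc, hbc, hfb, hfc⟩ := h.exists_normalized
  classical
  have hneg : ∀ x : G, -x = x := fun x => neg_eq_of_add_eq_zero_left (h2 x)
  have hsub : ∀ x y : G, x - y = x + y := fun x y => by rw [sub_eq_add_neg, hneg]
  have hbc0 : b + c ≠ 0 := by rwa [← hsub, sub_ne_zero]
  let s : Finset G := {0, b, c, b + c}
  have hs : s.card = 4 := by
    refine Finset.card_eq_succ.2 ⟨0, {b, c, b + c}, ?_, rfl, Finset.card_eq_three.2
      ⟨b, c, b + c, hbc, ?_, ?_, rfl⟩⟩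
    · simp [hb.symm, hc.symm, hbc0.symm]
    · simpa using hc
    · simpa using hb
  let W : AddSubgroup G :=
    { carrier := s
      zero_mem' := by simp [s]
      neg_mem' := by simp [hneg]
      add_mem' := by
        intro x y hx hy
        have e1 : b + (b + c) = c := by rw [← add_assoc, h2, zero_add]
        have e2 : c + (b + c) = b := by rw [add_left_comm, h2, add_zero]
        have e3 : b + c + b = c := by rw [add_comm, e1]
        have e4 : b + c + c = b := by rw [add_assoc, h2, add_zero]
        simp only [s, Finset.coe_insert, Finset.coe_singleton, Set.mem_insert_iff,
          Set.mem_singleton_iff] at hx hy ⊢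
        rcases hx with hx | hx | hx | hx <;> rcases hy with hy | hy | hy | hy <;> rw [hx, hy] <;>
          simp [h2, e1, e2, e3, e4, add_comm c b] }
  have hW : ∀ x, x ∈ W ↔ x = 0 ∨ x = b ∨ x = c ∨ x = b + c := by
    intro x
    change x ∈ (s : Set G) ↔ _
    simp [s]
  have hidx : W.index = 2 := by
    have hcW : Nat.card W = 4 := by
      rw [← hs]
      exact Nat.card_eq_card_toFinset (s : Set G) |>.trans (by simp)
    have := W.card_mul_index
    rw [hcW, Nat.card_eq_fintype_card, hcard] at this
    omega
  have hout : ∀ x ∉ W, f x = c ∨ f x - x = b := by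
    intro x hx
    have hx0 : x ≠ 0 := fun h => hx ((hW x).2 (by simp [h]))
    have hxb : x ≠ b := fun h => hx ((hW x).2 (by simp [h]))
    have hxc : x ≠ c := fun h => hx ((hW x).2 (by simp [h]))
    by_cases hfx : f x ∈ W
    · left
      rcases (hW _).1 hfx with h | h | h | h
      · exact absurd (hf.1.1 (h.trans h0.symm)) hx0
      · exact absurd (hf.1.1 (h.trans hfc.symm)) hxc
      · exact h
      · exact absurd (hf.1.1 (h.trans ((hsub b c).symm.trans hfb.symm))) hxb
    · right
      have hd : f x - x ∈ W := by
        rw [hsub, AddSubgroup.add_mem_iff_of_index_two hidx]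
        tauto
      rcases (hW _).1 hd with h | h | h | h
      · exact absurd (hf.2.1 (h.trans (by simp [h0]))) hx0
      · exact h
      · exact absurd (hf.2.1 (h.trans (by simp only [hfb, sub_sub_cancel_left, hneg]))) hxb
      · exact absurd (hf.2.1 (h.trans (by simp only [hfc, hsub]))) hxc
  obtain ⟨d, hd⟩ : ∃ d, d ∉ W := by
    by_contra! hall
    rw [AddSubgroup.index_eq_one.2 ((AddSubgroup.eq_top_iff' W).2 hall)] at hidx
    omega
  have hdb : d + b ∉ W := fun h => hd ((W.add_mem_cancel_right ((hW b).2 (by simp))).1 h)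
  have hdc : d + c ∉ W := fun h => hd ((W.add_mem_cancel_right ((hW c).2 (by simp))).1 h)
  have n1 : d ≠ d + b := by simpa using hb
  have n2 : d ≠ d + c := by simpa using hc
  have n3 : d + b ≠ d + c := by simpa using hbc
  have u1 : ∀ x y, x ≠ y → f x = c → f y = c → False := fun x y hxy hx hy =>
    hxy (hf.1.1 (hx.trans hy.symm))
  have u2 : ∀ x y, x ≠ y → f x - x = b → f y - y = b → False := fun x y hxy hx hy =>
    hxy (hf.2.1 (hx.trans hy.symm))
  rcases hout d hd with h | h <;> rcases hout _ hdb with h' | h' <;>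
    rcases hout _ hdc with h'' | h'' <;>
    first
      | exact u1 _ _ n1 h h'
      | exact u1 _ _ n2 h h''
      | exact u1 _ _ n3 h' h''
      | exact u2 _ _ n1 h h'
      | exact u2 _ _ n2 h h''
      | exact u2 _ _ n3 h' h''

end Small

/-! ### Finite fields -/

section Fields

variable {F : Type*} [Field F] [Fintype F]

lemma hasThreePointSwitch_iff_card :
    HasThreePointSwitch F ↔ Fintype.card F ∉ ({2, 5, 8} : Set ℕ) := by
  simp only [Set.mem_insert_iff, Set.mem_singleton_iff, not_or]
  constructor
  · intro h
    refine ⟨fun hF => ?_, fun hF => ?_, fun hF => ?_⟩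
    · obtain ⟨-, -, a, b, c, hab, hbc, hac, -, -⟩ := h
      have := Fintype.two_lt_card_iff.2 ⟨a, b, c, hab, hac, hbc⟩
      omega
    · have : Fact (Nat.Prime 5) := ⟨by norm_num⟩
      exact not_hasThreePointSwitch_zmod_five
        (h.of_addEquiv (ZMod.ringEquivOfPrime F Nat.prime_five hF).symm.toAddEquiv)
    · have : CharP F 2 := charP_of_card_eq_prime_pow (f := 3) (by simpa using hF)
      exact not_hasThreePointSwitch_of_card_eq_eight CharTwo.add_self_eq_zero hF h
  · rintro ⟨hF2, hF5, hF8⟩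
    obtain ⟨p, hp⟩ := CharP.exists F
    obtain ⟨k, hpp, hcard⟩ := FiniteField.card F p
    have : Fact p.Prime := ⟨hpp⟩
    by_cases hp25 : p = 2 ∨ p = 5
    · have hk : (k : ℕ) ≠ 1 := by
        intro hk
        rw [hk, pow_one] at hcard
        omega
      have hk0 := k.pos
      exact hasThreePointSwitch_of_card_eq_pow p k hcard (by omega) (hcard ▸ hF8)
    · rw [not_or] at hp25
      have h2 : (2 : F) ≠ 0 := by
        intro h
        have := (CharP.cast_eq_zero_iff F p 2).1 (by exact_mod_cast h)
        exact hp25.1 ((Nat.prime_dvd_prime_iff_eq hpp Nat.prime_two).1 this)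
      have h5 : (5 : F) ≠ 0 := by
        intro h
        have := (CharP.cast_eq_zero_iff F p 5).1 (by exact_mod_cast h)
        exact hp25.2 ((Nat.prime_dvd_prime_iff_eq hpp Nat.prime_five).1 this)
      by_cases h3 : IsSquare (-3 : F)
      · exact hasThreePointSwitch_of_isSquare_neg_three h2 h3
      by_cases h1 : IsSquare (-1 : F)
      · exact hasThreePointSwitch_of_isSquare_neg_one h2 h5 h1 h3
      · exact hasThreePointSwitch_of_not_isSquare_neg_one h1

lemma exists_eval_eq (f : F → F) : ∃ P : F[X], (fun x => P.eval x) = f := by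
  classical
  exact ⟨Lagrange.interpolate Finset.univ id f, funext fun x =>
    Lagrange.eval_interpolate_at_node f Function.injective_id.injOn (Finset.mem_univ x)⟩

end Fields

/-- Over every finite field, any two orthomorphism polynomials inducing different maps are at
Hamming distance at least 3, and distance exactly 3 occurs if and only if the order of the field
is not 2, 5 or 8. -/
theorem theorem1p3 (F : Type*) [Field F] [Fintype F] [DecidableEq F] :
    (∀ f g : F[X], IsOrthomorphismPolynomial f → IsOrthomorphismPolynomial g →
      (∃ a : F, f.eval a ≠ g.eval a) → 3 ≤ polyHammingDist f g) ∧
    ((∃ f g : F[X], IsOrthomorphismPolynomial f ∧ IsOrthomorphismPolynomial g ∧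
      polyHammingDist f g = 3) ↔ Fintype.card F ∉ ({2, 5, 8} : Set ℕ)) := by
  refine ⟨fun f g hf hg ⟨a, ha⟩ => IsOrthomorphism.three_le_hammingDist hf hg ha, ?_⟩
  rw [← hasThreePointSwitch_iff_card]
  constructor
  · rintro ⟨f, g, hf, hg, h⟩
    exact IsOrthomorphism.hasThreePointSwitch hf hg h
  · intro h
    obtain ⟨f, g, hf, hg, hfg⟩ := h.exists_hammingDist_eq_three
    obtain ⟨P, rfl⟩ := exists_eval_eq f
    obtain ⟨Q, rfl⟩ := exists_eval_eq g
    exact ⟨P, Q, hf, hg, hfg⟩
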